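/- Let $d\ge 1$ and let $K\colon\mathbb R^d\to[0,+\infty]$ be Lebesgue measurable, even (that is, $K(-x)=K(x)$ for a.e. $x$), and such that $\int_{\mathbb R^d}K(x)\,|x|\,dx<+\infty$. For $p\in\mathbb R^d$ set $$\sigma_K(p):=\frac12\int_{\mathbb R^d}K(z)\,|z\cdot p|\,dz .$$ Let $B$ be the open unit ball of $\mathbb R^d$ centred at the origin, let $\omega_{d-1}$ be the $(d-1)$-dimensional Lebesgue measure of the unit ball of $\mathbb R^{d-1}$ (with $\omega_0=1$), and for $\varepsilon>0$ and a Lebesgue measurable set $E\subset\mathbb R^d$ with characteristic function $\chi_E$ put $$K_\varepsilon(x):=\frac1{\varepsilon^d}K\Big(\frac x\varepsilon\Big),\qquad J^1_\varepsilon(E;B):=\frac12\int_B\int_B K_\varepsilon(y-x)\,|\chi_E(y)-\chi_E(x)|\,dy\,dx\in[0,+\infty].$$ For a unit vector $\hat p\in\mathbb R^d$ let $H_{\hat p}:=\{x\in\mathbb R^d: x\cdot\hat p>0\}$. Then for every unit vector $\hat p$, $$\sigma_K(\hat p)=\inf\Big\{\liminf_{\varepsilon\to0^+}\frac1{\omega_{d-1}\,\varepsilon}\,J^1_\varepsilon(E_\varepsilon;B)\;:\;E_\varepsilon\to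 H_{\hat p}\ \text{in }L^1(B)\Big\},$$ where the infimum is over all families $(E_\varepsilon)_{\varepsilon>0}$ of Lebesgue measurable subsets of $\mathbb R^d$ such that $\|\chi_{E_\varepsilon}-\chi_{H_{\hat p}}\|_{L^1(B)}\to0$ as $\varepsilon\to0^+$. -/

import Mathlib

open MeasureTheory Filter Topology
open scoped ENNReal

noncomputable section

namespace NonlocalPerimeter

/-- The Euclidean space `ℝ^d`, with its Euclidean norm and its Lebesgue measure `volume`. -/
abbrev Rd (d : ℕ) : Type := EuclideanSpace ℝ (Fin d)

/-- The characteristic function `χ_E` of a set `E ⊆ ℝ^d`. -/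
def chi {d : ℕ} (E : Set (Rd d)) : Rd d → ℝ := E.indicator (fun _ => 1)

/-- The open unit ball `B` of `ℝ^d` centred at the origin. -/
def unitBall (d : ℕ) : Set (Rd d) := Metric.ball 0 1

/-- `ω_k`, the `k`-dimensional Lebesgue measure of the unit ball of `ℝ^k` (so that `ω_0 = 1`). -/
def omega (k : ℕ) : ℝ≥0∞ := volume (unitBall k)

/-- The open halfspace `H_p = {x : x · p > 0}`. -/
def halfspace {d : ℕ} (p : Rd d) : Set (Rd d) := {x | 0 < inner ℝ x p}

/-- The rescaled kernel `K_ε(x) = ε^{-d} K(x / ε)`, meaningful for `ε > 0`. -/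
def rescale {d : ℕ} (K : Rd d → ℝ≥0∞) (ε : ℝ) (x : Rd d) : ℝ≥0∞ :=
  ENNReal.ofReal ((ε ^ d)⁻¹) * K (ε⁻¹ • x)

/-- The interior part of the rescaled nonlocal energy of a function,
`J¹_ε(u; Ω) = ½ ∫_Ω ∫_Ω K_ε(y - x) |u(y) - u(x)| dy dx`, with values in `[0, ∞]`. -/
def J1 {d : ℕ} (K : Rd d → ℝ≥0∞) (ε : ℝ) (u : Rd d → ℝ) (Ω : Set (Rd d)) : ℝ≥0∞ :=
  2⁻¹ * ∫⁻ x in Ω, ∫⁻ y in Ω, rescale K ε (y - x) * ‖u y - u x‖ₑ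

/-- The interior part of the rescaled nonlocal perimeter of a set, `J¹_ε(E; Ω) = J¹_ε(χ_E; Ω)`. -/
def J1Set {d : ℕ} (K : Rd d → ℝ≥0∞) (ε : ℝ) (E Ω : Set (Rd d)) : ℝ≥0∞ :=
  J1 K ε (chi E) Ω

/-- The anisotropic norm `σ_K(p) = ½ ∫ K(z) |z · p| dz`. -/
def sigma {d : ℕ} (K : Rd d → ℝ≥0∞) (p : Rd d) : ℝ≥0∞ :=
  2⁻¹ * ∫⁻ z, K z * ‖(inner ℝ z p : ℝ)‖ₑ

/-- `E_ε → F` in `L¹(Ω)` as `ε → 0⁺`, that is, `‖χ_{E_ε} - χ_F‖_{L¹(Ω)} → 0`. -/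
def TendstoL1 {d : ℕ} (E : ℝ → Set (Rd d)) (F Ω : Set (Rd d)) : Prop :=
  Tendsto (fun ε : ℝ => eLpNorm (chi (E ε) - chi F) 1 (volume.restrict Ω)) (𝓝[>] 0) (𝓝 0)

/-- Families `(E_ε)_{ε > 0}` of Lebesgue measurable subsets of `ℝ^d` that converge to the
halfspace `H_p` in `L¹(B)` as `ε → 0⁺` (the sets with index `ε ≤ 0` are irrelevant). -/
def admissible {d : ℕ} (p : Rd d) : Set (ℝ → Set (Rd d)) :=
  {E | (∀ ε : ℝ, 0 < ε → NullMeasurableSet (E ε) volume) ∧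
    TendstoL1 E (halfspace p) (unitBall d)}

end NonlocalPerimeter

end

/-!
Substituting `y = x + ε z` and exchanging the integrals gives `J¹_ε(u; B) = ½ ∫ K(z) V(u, ε z) dz`,
where `V(u, v)` is the variation of `u` under the translation by `v`, computed inside `B`.

If `u` is the characteristic function of `H_p`, then `|u(x + v) - u(x)|` is that of a slab of width
`|v · p|`, which meets `B` in measure at most `ω_{d-1} |v · p|`. Hence the constant family `H_p`
attains at most `σ_K(p)`.

Conversely, by Fatou's lemma it suffices to bound the lower limit of `V(u_ε, ε z) / (ω_{d-1} ε)`
from below by `|z · p|` for each `z`. Since the convergence in `L¹` comes without a rate, the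
translations by `ε z` cannot be compared directly with those of `H_p`. Instead, `N ≈ t / ε` of them
are chained into one translation by roughly `t z`, with `t` fixed: `N V(u_ε, ε z)` dominates the
variation of `u_ε` under it, in a ball that is smaller by a multiple of `t`, and division by `N ε`
leaves an `L¹` error of order `‖u_ε - χ_{H_p}‖₁ / t`. Then `ε → 0`, and finally `t → 0`.
-/

namespace NonlocalPerimeter

open Module (finrank)

theorem lintegral_liminf_le_of_eventually {α ι : Type*} [MeasurableSpace α] {μ : Measure α}
    {l : Filter ι} [l.IsCountablyGenerated] {f : ι → α → ℝ≥0∞}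
    (hf : ∀ᶠ i in l, AEMeasurable (f i) μ) :
    ∫⁻ a, liminf (fun i => f i a) l ∂μ ≤ liminf (fun i => ∫⁻ a, f i a ∂μ) l := by
  classical
  let g : ι → α → ℝ≥0∞ := fun i => if AEMeasurable (f i) μ then f i else 0
  have hfg : ∀ᶠ i in l, f i = g i := hf.mono fun i hi => (if_pos hi).symm
  have hg : ∀ i, AEMeasurable (g i) μ := fun i => by
    dsimp only [g]
    by_cases hi : AEMeasurable (f i) μ
    · rwa [if_pos hi]
    · rw [if_neg hi]
      exact aemeasurable_zero
  calc ∫⁻ a, liminf (fun i => f i a) l ∂μ = ∫⁻ a, liminf (fun i => g i a) l ∂μ :=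
        lintegral_congr fun a => liminf_congr (hfg.mono fun i hi => congrFun hi a)
    _ ≤ liminf (fun i => ∫⁻ a, g i a ∂μ) l := lintegral_liminf_le' hg
    _ = liminf (fun i => ∫⁻ a, f i a ∂μ) l :=
        liminf_congr (hfg.mono fun i hi => by rw [hi])

theorem const_mul_liminf_le {ι : Type*} {l : Filter ι} [l.NeBot] (c : ℝ≥0∞) (f : ι → ℝ≥0∞) :
    c * liminf f l ≤ liminf (fun i => c * f i) l := by
  simpa [Pi.mul_def] using ENNReal.le_liminf_mul (u := fun _ : ι => c) (v := f) (f := l)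

section Translation

variable {G F : Type*} [MeasurableSpace G] [AddGroup G] [NormedAddCommGroup F]
  {μ : Measure G} {Ω A : Set G} {u h : G → F}

/-- The variation `∫_{Ω ∩ (Ω - v)} |u(x + v) - u(x)| dμ(x)` of `u` under the translation by `v`,
where only the pairs `x`, `x + v` that both lie in `Ω` are taken into account. -/
noncomputable def translationVariation (μ : Measure G) (Ω : Set G) (u : G → F) (v : G) : ℝ≥0∞ :=
  ∫⁻ x in Ω ∩ (· + v) ⁻¹' Ω, ‖u (x + v) - u x‖ₑ ∂μ

theorem setLIntegral_comp_add_right_le [MeasurableAdd G] [μ.IsAddRightInvariant] {w : G}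
    (hA : Set.MapsTo (· + w) A Ω) (f : G → ℝ≥0∞) :
    ∫⁻ x in A, f (x + w) ∂μ ≤ ∫⁻ x in Ω, f x ∂μ :=
  (lintegral_mono_set hA).trans_eq <|
    (measurePreserving_add_right μ w).setLIntegral_comp_preimage_emb
      (measurableEmbedding_addRight w) f Ω

theorem aestronglyMeasurable_comp_add_right [MeasurableAdd G] [μ.IsAddRightInvariant]
    (hu : AEStronglyMeasurable u μ) (w : G) : AEStronglyMeasurable (fun x => u (x + w)) μ :=
  hu.comp_measurePreserving (measurePreserving_add_right μ w)

theorem setLIntegral_enorm_add_nsmul_sub_le [MeasurableAdd G] [μ.IsAddRightInvariant]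
    (hu : AEStronglyMeasurable u μ) {v : G} {n : ℕ}
    (hA : ∀ k ≤ n, Set.MapsTo (· + k • v) A Ω) :
    ∫⁻ x in A, ‖u (x + n • v) - u x‖ₑ ∂μ ≤ n * translationVariation μ Ω u v := by
  induction n with
  | zero => simp
  | succ n ih =>
    have hlast : Set.MapsTo (· + n • v) A (Ω ∩ (· + v) ⁻¹' Ω) := fun x hx =>
      ⟨hA n n.le_succ hx, by simpa [succ_nsmul, add_assoc] using hA (n + 1) le_rfl hx⟩
    have hmeas : AEMeasurable (fun x => ‖u (x + n • v) - u x‖ₑ) (μ.restrict A) :=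
      ((aestronglyMeasurable_comp_add_right hu _).sub hu).restrict.enorm
    calc ∫⁻ x in A, ‖u (x + (n + 1) • v) - u x‖ₑ ∂μ
        ≤ ∫⁻ x in A, (‖u (x + n • v + v) - u (x + n • v)‖ₑ + ‖u (x + n • v) - u x‖ₑ) ∂μ := by
          refine lintegral_mono fun x => ?_
          rw [succ_nsmul, ← add_assoc, ← sub_add_sub_cancel _ (u (x + n • v))]
          exact enorm_add_le _ _
      _ = ∫⁻ x in A, ‖u (x + n • v + v) - u (x + n • v)‖ₑ ∂μ +
            ∫⁻ x in A, ‖u (x + n • v) - u x‖ₑ ∂μ := lintegral_add_right' _ hmeas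
      _ ≤ translationVariation μ Ω u v + n * translationVariation μ Ω u v :=
          add_le_add (setLIntegral_comp_add_right_le hlast fun y => ‖u (y + v) - u y‖ₑ)
            (ih fun k hk => hA k (hk.trans n.le_succ))
      _ = (n + 1 : ℕ) * translationVariation μ Ω u v := by push_cast; ring

theorem setLIntegral_enorm_add_sub_le_add [MeasurableAdd G] [μ.IsAddRightInvariant]
    (hu : AEStronglyMeasurable u μ) (hh : AEStronglyMeasurable h μ) {w : G} (hA : A ⊆ Ω)
    (hAw : Set.MapsTo (· + w) A Ω) :
    ∫⁻ x in A, ‖h (x + w) - h x‖ₑ ∂μ ≤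
      ∫⁻ x in A, ‖u (x + w) - u x‖ₑ ∂μ + 2 * eLpNorm (u - h) 1 (μ.restrict Ω) := by
  set e : G → ℝ≥0∞ := fun x => ‖u x - h x‖ₑ
  have he : AEMeasurable e (μ.restrict A) := (hu.sub hh).restrict.enorm
  have hew : AEMeasurable (fun x => e (x + w)) (μ.restrict A) :=
    (aestronglyMeasurable_comp_add_right (hu.sub hh) w).restrict.enorm
  calc ∫⁻ x in A, ‖h (x + w) - h x‖ₑ ∂μ
      ≤ ∫⁻ x in A, (‖u (x + w) - u x‖ₑ + (e (x + w) + e x)) ∂μ := by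
        refine lintegral_mono fun x => ?_
        have hsplit : h (x + w) - h x =
            u (x + w) - u x + (-(u (x + w) - h (x + w)) + (u x - h x)) := by abel
        rw [hsplit]
        refine (enorm_add_le _ _).trans ?_
        gcongr
        exact (enorm_add_le _ _).trans_eq (by rw [enorm_neg])
    _ = ∫⁻ x in A, ‖u (x + w) - u x‖ₑ ∂μ +
          (∫⁻ x in A, e (x + w) ∂μ + ∫⁻ x in A, e x ∂μ) := by
        rw [← lintegral_add_right' _ he]
        exact lintegral_add_right' _ (hew.add he)
    _ ≤ ∫⁻ x in A, ‖u (x + w) - u x‖ₑ ∂μ + (∫⁻ x in Ω, e x ∂μ + ∫⁻ x in Ω, e x ∂μ) := by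
        gcongr _ + (?_ + ?_)
        · exact setLIntegral_comp_add_right_le hAw e
        · exact lintegral_mono_set hA
    _ = ∫⁻ x in A, ‖u (x + w) - u x‖ₑ ∂μ + 2 * eLpNorm (u - h) 1 (μ.restrict Ω) := by
        rw [← two_mul, eLpNorm_one_eq_lintegral_enorm]
        rfl

theorem translationVariation_eq_setLIntegral_indicator [MeasurableAdd G] (hΩ : MeasurableSet Ω)
    (u : G → F) (v : G) :
    translationVariation μ Ω u v =
      ∫⁻ x in Ω, Ω.indicator (fun y => ‖u y - u x‖ₑ) (x + v) ∂μ := by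
  rw [translationVariation, Set.inter_comm, ← setLIntegral_indicator (measurable_add_const v hΩ)]
  rfl

variable {Z : Type*} [MeasurableSpace Z] {ν : Measure Z} {τ : Z → G}

theorem aemeasurable_indicator_enorm_sub_comp_add [MeasurableAdd₂ G] [SFinite μ]
    [μ.IsAddRightInvariant] [SFinite ν] (hΩ : MeasurableSet Ω) (hu : AEStronglyMeasurable u μ)
    (hτ : Measurable τ) :
    AEMeasurable (fun q : G × Z => Ω.indicator (fun y => ‖u y - u q.1‖ₑ) (q.1 + τ q.2))
      ((μ.restrict Ω).prod ν) := by
  have hshift : Measurable fun q : G × Z => q.1 + τ q.2 := by fun_prop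
  have hqmp : Measure.QuasiMeasurePreserving (fun q : G × Z => q.1 + τ q.2) (μ.prod ν) μ :=
    QuasiMeasurePreserving.prod_of_left hshift <| .of_forall fun z =>
      (measurePreserving_add_right μ (τ z)).quasiMeasurePreserving
  have hdiff : AEMeasurable (fun q : G × Z => ‖u (q.1 + τ q.2) - u q.1‖ₑ) (μ.prod ν) :=
    ((hu.comp_quasiMeasurePreserving hqmp).sub hu.comp_fst).enorm
  exact (hdiff.indicator (hshift hΩ)).mono_ac
    (Measure.restrict_le_self.absolutelyContinuous.prod .rfl)

theorem aemeasurable_translationVariation_comp [MeasurableAdd₂ G] [SFinite μ]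
    [μ.IsAddRightInvariant] [SFinite ν] (hΩ : MeasurableSet Ω) (hu : AEStronglyMeasurable u μ)
    (hτ : Measurable τ) : AEMeasurable (fun z => translationVariation μ Ω u (τ z)) ν := by
  simp only [translationVariation_eq_setLIntegral_indicator hΩ]
  exact (aemeasurable_indicator_enorm_sub_comp_add hΩ hu hτ).lintegral_prod_left'

theorem setLIntegral_lintegral_mul_indicator [MeasurableAdd₂ G] [SFinite μ]
    [μ.IsAddRightInvariant] [SFinite ν] (hΩ : MeasurableSet Ω) (hu : AEStronglyMeasurable u μ)
    (hτ : Measurable τ) {K : Z → ℝ≥0∞} (hK : AEMeasurable K ν) :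
    ∫⁻ x in Ω, ∫⁻ z, K z * Ω.indicator (fun y => ‖u y - u x‖ₑ) (x + τ z) ∂ν ∂μ =
      ∫⁻ z, K z * translationVariation μ Ω u (τ z) ∂ν := by
  have hind := aemeasurable_indicator_enorm_sub_comp_add (ν := ν) hΩ hu hτ
  rw [lintegral_lintegral_swap (hK.comp_snd.mul hind)]
  refine lintegral_congr fun z => ?_
  have hz : AEMeasurable (fun x => Ω.indicator (fun y => ‖u y - u x‖ₑ) (x + τ z))
      (μ.restrict Ω) :=
    (((aestronglyMeasurable_comp_add_right hu (τ z)).sub hu).enorm.indicator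
      (measurable_add_const (τ z) hΩ)).restrict
  rw [lintegral_const_mul'' _ hz, translationVariation_eq_setLIntegral_indicator hΩ]

end Translation

section Rescaling

theorem lintegral_eq_ofReal_pow_mul_lintegral_add_smul {V : Type*} [NormedAddCommGroup V]
    [NormedSpace ℝ V] [FiniteDimensional ℝ V] [MeasurableSpace V] [BorelSpace V] (μ : Measure V)
    [μ.IsAddHaarMeasure] (f : V → ℝ≥0∞) (x : V) {ε : ℝ} (hε : 0 < ε) :
    ∫⁻ y, f y ∂μ = ENNReal.ofReal (ε ^ finrank ℝ V) * ∫⁻ z, f (x + ε • z) ∂μ := by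
  have hmap := (measurableEmbedding_const_smul₀ hε.ne').lintegral_map (μ := μ) fun y => f (x + y)
  rw [Measure.map_addHaar_smul μ hε.ne', lintegral_smul_measure, lintegral_add_left_eq_self f x,
    abs_of_pos (by positivity), smul_eq_mul] at hmap
  rw [← hmap, ← mul_assoc, ← ENNReal.ofReal_mul (by positivity), mul_inv_cancel₀ (by positivity),
    ENNReal.ofReal_one, one_mul]

variable {d : ℕ} {K : Rd d → ℝ≥0∞} {Ω : Set (Rd d)} {u : Rd d → ℝ} {ε : ℝ}

theorem setLIntegral_rescale_mul (K : Rd d → ℝ≥0∞) (hΩ : MeasurableSet Ω) (f : Rd d → ℝ≥0∞)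
    (x : Rd d) (hε : 0 < ε) :
    ∫⁻ y in Ω, rescale K ε (y - x) * f y = ∫⁻ z, K z * Ω.indicator f (x + ε • z) := by
  rw [← lintegral_indicator hΩ, lintegral_eq_ofReal_pow_mul_lintegral_add_smul volume _ x hε,
    ← lintegral_const_mul' _ _ ENNReal.ofReal_ne_top, finrank_euclideanSpace_fin]
  refine lintegral_congr fun z => ?_
  have hcancel : ENNReal.ofReal (ε ^ d) * ENNReal.ofReal (ε ^ d)⁻¹ = 1 := by
    rw [← ENNReal.ofReal_mul (by positivity), mul_inv_cancel₀ (by positivity), ENNReal.ofReal_one]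
  rw [Set.indicator_mul_right, rescale, add_sub_cancel_left, inv_smul_smul₀ hε.ne', ← mul_assoc,
    ← mul_assoc, hcancel, one_mul]

theorem J1_eq_lintegral_translationVariation (hK : AEMeasurable K) (hΩ : MeasurableSet Ω)
    (hu : AEStronglyMeasurable u) (hε : 0 < ε) :
    J1 K ε u Ω = 2⁻¹ * ∫⁻ z, K z * translationVariation volume Ω u (ε • z) := by
  simp only [J1, setLIntegral_rescale_mul K hΩ _ _ hε]
  rw [setLIntegral_lintegral_mul_indicator hΩ hu (measurable_const_smul ε) hK]

theorem const_mul_J1_eq_lintegral (hK : AEMeasurable K) (hΩ : MeasurableSet Ω)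
    (hu : AEStronglyMeasurable u) (hε : 0 < ε) {c : ℝ≥0∞} (hc : c ≠ ∞) :
    c * J1 K ε u Ω = 2⁻¹ * ∫⁻ z, K z * (c * translationVariation volume Ω u (ε • z)) := by
  rw [J1_eq_lintegral_translationVariation hK hΩ hu hε, mul_left_comm,
    ← lintegral_const_mul' c _ hc]
  simp only [mul_left_comm c]

end Rescaling

section Slab

variable {V : Type*} [NormedAddCommGroup V] [InnerProductSpace ℝ V] [FiniteDimensional ℝ V]
  [MeasurableSpace V] [BorelSpace V] {n : ℕ} {p : V} {I : Set ℝ}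

theorem exists_measurePreserving_prod_orthogonal (hV : finrank ℝ V = n + 1) (hp : ‖p‖ = 1) :
    ∃ f : V → ℝ × Rd n, MeasurePreserving f ∧
      ∀ x, (f x).1 = inner ℝ x p ∧ ‖x‖ ^ 2 = (f x).1 ^ 2 + ‖(f x).2‖ ^ 2 := by
  obtain ⟨b, hb⟩ := Orthonormal.exists_orthonormalBasis_extension_of_card_eq (𝕜 := ℝ)
    (E := V) (ι := Fin (n + 1)) (by simpa using hV) (v := fun _ => p) (s := {0})
    ⟨fun _ => hp, fun i j hij => absurd (Subsingleton.elim i j) hij⟩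
  have hb0 : b 0 = p := hb 0 rfl
  have hcoord := (PiLp.volume_preserving_ofLp (Fin (n + 1))).comp b.measurePreserving_repr
  have hsplit := volume_preserving_piFinSuccAbove (fun _ : Fin (n + 1) => ℝ) 0
  have htail := (MeasurePreserving.id (volume : Measure ℝ)).prod
    (PiLp.volume_preserving_toLp (Fin n))
  refine ⟨_, htail.comp (hsplit.comp hcoord), fun x => ⟨?_, ?_⟩⟩
  · simp [MeasurableEquiv.piFinSuccAbove, OrthonormalBasis.repr_apply_apply, hb0,
      real_inner_comm]
  · rw [← b.repr.norm_map x, EuclideanSpace.real_norm_sq_eq, Fin.sum_univ_succ,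
      EuclideanSpace.real_norm_sq_eq]
    simp [MeasurableEquiv.piFinSuccAbove, Fin.tail]

theorem volume_slab_inter_ball_le (hV : finrank ℝ V = n + 1) (hp : ‖p‖ = 1)
    (hI : MeasurableSet I) (R : ℝ) :
    volume ({x : V | inner ℝ x p ∈ I} ∩ Metric.ball 0 R) ≤
      volume I * volume (Metric.ball (0 : Rd n) R) := by
  obtain ⟨f, hf, hfx⟩ := exists_measurePreserving_prod_orthogonal hV hp
  calc volume ({x : V | inner ℝ x p ∈ I} ∩ Metric.ball 0 R)
      ≤ volume (f ⁻¹' (I ×ˢ Metric.ball 0 R)) := by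
        refine measure_mono fun x ⟨hxI, hxR⟩ => ⟨(hfx x).1 ▸ hxI, ?_⟩
        rw [mem_ball_zero_iff] at hxR ⊢
        refine lt_of_le_of_lt (le_of_sq_le_sq ?_ (norm_nonneg x)) hxR
        linarith [(hfx x).2, sq_nonneg (f x).1]
    _ = volume I * volume (Metric.ball (0 : Rd n) R) := by
        rw [hf.measure_preimage (hI.prod measurableSet_ball).nullMeasurableSet,
          Measure.volume_eq_prod, Measure.prod_prod]

theorem le_volume_slab_inter_ball (hV : finrank ℝ V = n + 1) (hp : ‖p‖ = 1)
    (hI : MeasurableSet I) {s : ℝ} (hIs : ∀ t ∈ I, |t| ≤ s) (R : ℝ) :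
    volume I * volume (Metric.ball (0 : Rd n) (R - s)) ≤
      volume ({x : V | inner ℝ x p ∈ I} ∩ Metric.ball 0 R) := by
  obtain ⟨f, hf, hfx⟩ := exists_measurePreserving_prod_orthogonal hV hp
  calc volume I * volume (Metric.ball (0 : Rd n) (R - s))
      = volume (f ⁻¹' (I ×ˢ Metric.ball 0 (R - s))) := by
        rw [hf.measure_preimage (hI.prod measurableSet_ball).nullMeasurableSet,
          Measure.volume_eq_prod, Measure.prod_prod]
    _ ≤ volume ({x : V | inner ℝ x p ∈ I} ∩ Metric.ball 0 R) := by
        refine measure_mono fun x ⟨hxI, hxR⟩ => ⟨by rwa [Set.mem_ofPred_eq, ← (hfx x).1], ?_⟩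
        rw [mem_ball_zero_iff] at hxR ⊢
        have hnorm : ‖x‖ ≤ |(f x).1| + ‖(f x).2‖ := by
          refine le_of_sq_le_sq ?_ (by positivity)
          rw [(hfx x).2, ← sq_abs (f x).1]
          nlinarith [abs_nonneg (f x).1, norm_nonneg (f x).2]
        linarith [hIs _ hxI]

end Slab

section Halfspace

theorem aestronglyMeasurable_chi {d : ℕ} {E : Set (Rd d)} (hE : NullMeasurableSet E) :
    AEStronglyMeasurable (chi E) :=
  aestronglyMeasurable_const.indicator₀ hE

theorem nullMeasurableSet_halfspace {d : ℕ} (p : Rd d) : NullMeasurableSet (halfspace p) :=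
  (measurableSet_lt measurable_const (by fun_prop)).nullMeasurableSet

theorem const_halfspace_mem_admissible {d : ℕ} (p : Rd d) :
    (fun _ : ℝ => halfspace p) ∈ admissible p :=
  ⟨fun _ _ => nullMeasurableSet_halfspace p, by simp [TendstoL1]⟩

theorem enorm_chi_halfspace_add_sub {d : ℕ} (p w x : Rd d) :
    ‖chi (halfspace p) (x + w) - chi (halfspace p) x‖ₑ =
      {y : Rd d | inner ℝ y p ∈ Set.uIoc 0 (-inner ℝ w p)}.indicator 1 x := by
  simp only [chi, halfspace, Set.indicator_apply, Set.mem_ofPred_eq, inner_add_left,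
    Set.mem_uIoc]
  split_ifs <;> first | (exfalso; grind) | simp

theorem setLIntegral_enorm_chi_halfspace_add_sub {d : ℕ} (p w : Rd d) (A : Set (Rd d)) :
    ∫⁻ x in A, ‖chi (halfspace p) (x + w) - chi (halfspace p) x‖ₑ =
      volume ({x : Rd d | inner ℝ x p ∈ Set.uIoc 0 (-inner ℝ w p)} ∩ A) := by
  have hslab : MeasurableSet {x : Rd d | inner ℝ x p ∈ Set.uIoc 0 (-inner ℝ w p)} :=
    (by fun_prop : Measurable fun x : Rd d => (inner ℝ x p : ℝ)) measurableSet_uIoc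
  simp only [enorm_chi_halfspace_add_sub]
  rw [lintegral_indicator_one hslab, Measure.restrict_apply hslab]

theorem enorm_inner_smul {V : Type*} [NormedAddCommGroup V] [InnerProductSpace ℝ V] (p z : V)
    {t : ℝ} (ht : 0 ≤ t) :
    ‖(inner ℝ (t • z) p : ℝ)‖ₑ = ENNReal.ofReal t * ‖(inner ℝ z p : ℝ)‖ₑ := by
  rw [real_inner_smul_left, enorm_mul, Real.enorm_of_nonneg ht]

theorem volume_uIoc_zero_neg (a : ℝ) : volume (Set.uIoc 0 (-a)) = ‖a‖ₑ := by
  rw [Real.volume_uIoc, sub_zero, abs_neg, Real.enorm_eq_ofReal_abs]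

theorem omega_mul_ofReal_ne_zero (k : ℕ) {t : ℝ} (ht : 0 < t) :
    omega k * ENNReal.ofReal t ≠ 0 :=
  mul_ne_zero (Metric.measure_ball_pos volume 0 one_pos).ne' (ENNReal.ofReal_pos.2 ht).ne'

theorem omega_mul_ofReal_ne_top (k : ℕ) (t : ℝ) : omega k * ENNReal.ofReal t ≠ ∞ :=
  ENNReal.mul_ne_top measure_ball_lt_top.ne ENNReal.ofReal_ne_top

variable {n : ℕ} {p : Rd (n + 1)}

theorem translationVariation_halfspace_le (hp : ‖p‖ = 1) (v : Rd (n + 1)) :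
    translationVariation volume (unitBall (n + 1)) (chi (halfspace p)) v ≤
      omega n * ‖(inner ℝ v p : ℝ)‖ₑ := by
  refine (lintegral_mono_set Set.inter_subset_left).trans ?_
  rw [setLIntegral_enorm_chi_halfspace_add_sub, ← volume_uIoc_zero_neg, mul_comm]
  exact volume_slab_inter_ball_le finrank_euclideanSpace_fin hp measurableSet_uIoc 1

theorem inv_mul_translationVariation_halfspace_le (hp : ‖p‖ = 1) (z : Rd (n + 1)) {ε : ℝ}
    (hε : 0 < ε) :
    (omega n * ENNReal.ofReal ε)⁻¹ *
        translationVariation volume (unitBall (n + 1)) (chi (halfspace p)) (ε • z) ≤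
      ‖(inner ℝ z p : ℝ)‖ₑ := by
  rw [ENNReal.inv_mul_le_iff (omega_mul_ofReal_ne_zero n hε) (omega_mul_ofReal_ne_top n ε),
    mul_assoc, ← enorm_inner_smul p z hε.le]
  exact translationVariation_halfspace_le hp (ε • z)

theorem le_setLIntegral_enorm_chi_halfspace_add_sub (hp : ‖p‖ = 1) {w : Rd (n + 1)} {s : ℝ}
    (hws : ‖w‖ ≤ s) (hs : 2 * s < 1) :
    omega n * ‖(inner ℝ w p : ℝ)‖ₑ * ENNReal.ofReal ((1 - 2 * s) ^ n) ≤
      ∫⁻ x in Metric.ball 0 (1 - s), ‖chi (halfspace p) (x + w) - chi (halfspace p) x‖ₑ := by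
  have hinner : |(inner ℝ w p : ℝ)| ≤ s :=
    (abs_real_inner_le_norm w p).trans (by rwa [hp, mul_one])
  have hI : ∀ t ∈ Set.uIoc 0 (-inner ℝ w p), |t| ≤ s := fun t ht => by
    have := Set.abs_sub_left_of_mem_uIcc (Set.uIoc_subset_uIcc ht)
    rw [sub_zero, sub_zero, abs_neg] at this
    exact this.trans hinner
  rw [setLIntegral_enorm_chi_halfspace_add_sub]
  refine le_trans (le_of_eq ?_)
    (le_volume_slab_inter_ball finrank_euclideanSpace_fin hp measurableSet_uIoc hI (1 - s))
  rw [volume_uIoc_zero_neg, Measure.addHaar_ball_of_pos _ _ (by linarith),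
    finrank_euclideanSpace_fin, omega, unitBall]
  ring_nf

end Halfspace

section LowerBound

variable {n : ℕ} {p : Rd (n + 1)}

theorem mapsTo_add_ball {V : Type*} [SeminormedAddCommGroup V] {w : V} {s : ℝ} (hw : ‖w‖ ≤ s)
    (R : ℝ) : Set.MapsTo (· + w) (Metric.ball (0 : V) (R - s)) (Metric.ball 0 R) := fun x hx => by
  rw [mem_ball_zero_iff] at hx ⊢
  linarith [norm_add_le x w]

theorem omega_mul_enorm_inner_mul_le (hp : ‖p‖ = 1) {u : Rd (n + 1) → ℝ}
    (hu : AEStronglyMeasurable u) (v : Rd (n + 1)) (N : ℕ) {s : ℝ} (hNs : N * ‖v‖ ≤ s)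
    (hs : 2 * s < 1) :
    omega n * ‖(inner ℝ ((N : ℝ) • v) p : ℝ)‖ₑ * ENNReal.ofReal ((1 - 2 * s) ^ n) ≤
      N * translationVariation volume (unitBall (n + 1)) u v +
        2 * eLpNorm (u - chi (halfspace p)) 1 (volume.restrict (unitBall (n + 1))) := by
  have hmaps : ∀ k ≤ N,
      Set.MapsTo (· + k • v) (Metric.ball 0 (1 - s)) (unitBall (n + 1)) := fun k hk =>
    mapsTo_add_ball (norm_nsmul_le.trans (le_trans (by gcongr) hNs)) 1
  have hsub : Metric.ball 0 (1 - s) ⊆ unitBall (n + 1) := by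
    simpa using! hmaps 0 N.zero_le
  have hw : ‖N • v‖ ≤ s := norm_nsmul_le.trans hNs
  rw [Nat.cast_smul_eq_nsmul]
  calc omega n * ‖(inner ℝ (N • v) p : ℝ)‖ₑ * ENNReal.ofReal ((1 - 2 * s) ^ n)
      ≤ ∫⁻ x in Metric.ball 0 (1 - s),
          ‖chi (halfspace p) (x + N • v) - chi (halfspace p) x‖ₑ :=
        le_setLIntegral_enorm_chi_halfspace_add_sub hp hw hs
    _ ≤ (∫⁻ x in Metric.ball 0 (1 - s), ‖u (x + N • v) - u x‖ₑ) +
          2 * eLpNorm (u - chi (halfspace p)) 1 (volume.restrict (unitBall (n + 1))) :=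
        setLIntegral_enorm_add_sub_le_add hu
          (aestronglyMeasurable_chi (nullMeasurableSet_halfspace p)) hsub (hmaps N le_rfl)
    _ ≤ _ := by
        gcongr
        exact setLIntegral_enorm_add_nsmul_sub_le hu hmaps

theorem exists_nat_mul_mem_Icc {R : Type*} [Field R] [LinearOrder R] [IsStrictOrderedRing R]
    [FloorSemiring R] {ε t : R} (hε : 0 < ε) (hεt : ε ≤ t) :
    ∃ N : ℕ, N * ε ∈ Set.Icc t (2 * t) := by
  refine ⟨⌈t / ε⌉₊, (div_le_iff₀ hε).1 (Nat.le_ceil _), ?_⟩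
  have hceil := Nat.ceil_lt_add_one (div_nonneg (hε.le.trans hεt) hε.le)
  rw [div_add_one hε.ne', lt_div_iff₀ hε] at hceil
  linarith

theorem enorm_inner_mul_le_inv_mul_translationVariation_add (hp : ‖p‖ = 1)
    {u : Rd (n + 1) → ℝ} (hu : AEStronglyMeasurable u) (z : Rd (n + 1)) {t ε : ℝ} (hε : 0 < ε)
    (hεt : ε ≤ t) (htz : 4 * t * ‖z‖ < 1) :
    ‖(inner ℝ z p : ℝ)‖ₑ * ENNReal.ofReal ((1 - 4 * t * ‖z‖) ^ n) ≤
      (omega n * ENNReal.ofReal ε)⁻¹ *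
          translationVariation volume (unitBall (n + 1)) u (ε • z) +
        (omega n * ENNReal.ofReal t)⁻¹ *
          (2 * eLpNorm (u - chi (halfspace p)) 1 (volume.restrict (unitBall (n + 1)))) := by
  obtain ⟨N, ht_le, hle_t⟩ := exists_nat_mul_mem_Icc hε hεt
  have hNε : 0 < N * ε := (hε.trans_le hεt).trans_le ht_le
  have hN0 : (N : ℝ≥0∞) ≠ 0 := by
    rintro h
    simp [Nat.cast_eq_zero.1 h] at hNε
  have hNz : N * ‖ε • z‖ ≤ 2 * t * ‖z‖ := by
    rw [norm_smul, Real.norm_of_nonneg hε.le, ← mul_assoc]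
    gcongr
  have key := omega_mul_enorm_inner_mul_le hp hu (ε • z) N hNz (by linarith)
  rw [smul_smul, enorm_inner_smul p z (by positivity), ← mul_assoc, mul_assoc,
    show 2 * (2 * t * ‖z‖) = 4 * t * ‖z‖ by ring] at key
  have hcoef : (omega n * ENNReal.ofReal (N * ε))⁻¹ * N = (omega n * ENNReal.ofReal ε)⁻¹ := by
    rw [ENNReal.ofReal_mul N.cast_nonneg, ENNReal.ofReal_natCast, mul_left_comm,
      ENNReal.mul_inv (.inl hN0) (.inl (ENNReal.natCast_ne_top N)), mul_right_comm,
      ENNReal.inv_mul_cancel hN0 (ENNReal.natCast_ne_top N), one_mul]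
  rw [ENNReal.mul_le_iff_le_inv (omega_mul_ofReal_ne_zero n hNε) (omega_mul_ofReal_ne_top n _),
    mul_add, ← mul_assoc, hcoef] at key
  refine key.trans ?_
  gcongr

theorem enorm_inner_le_liminf_translationVariation (hp : ‖p‖ = 1) {u : ℝ → Rd (n + 1) → ℝ}
    (hu : ∀ᶠ ε in 𝓝[>] 0, AEStronglyMeasurable (u ε))
    (hlim : Tendsto (fun ε => eLpNorm (u ε - chi (halfspace p)) 1
      (volume.restrict (unitBall (n + 1)))) (𝓝[>] 0) (𝓝 0)) (z : Rd (n + 1)) :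
    ‖(inner ℝ z p : ℝ)‖ₑ ≤ liminf (fun ε : ℝ => (omega n * ENNReal.ofReal ε)⁻¹ *
      translationVariation volume (unitBall (n + 1)) (u ε) (ε • z)) (𝓝[>] 0) := by
  have hbound : ∀ t : ℝ, 0 < t → 4 * t * ‖z‖ < 1 →
      ‖(inner ℝ z p : ℝ)‖ₑ * ENNReal.ofReal ((1 - 4 * t * ‖z‖) ^ n) ≤
        liminf (fun ε : ℝ => (omega n * ENNReal.ofReal ε)⁻¹ *
          translationVariation volume (unitBall (n + 1)) (u ε) (ε • z)) (𝓝[>] 0) := by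
    intro t ht htz
    have herror : Tendsto (fun ε => (omega n * ENNReal.ofReal t)⁻¹ * (2 * eLpNorm
        (u ε - chi (halfspace p)) 1 (volume.restrict (unitBall (n + 1))))) (𝓝[>] 0) (𝓝 0) := by
      simpa using ENNReal.Tendsto.const_mul
        (ENNReal.Tendsto.const_mul hlim (.inr ENNReal.ofNat_ne_top))
        (.inr (ENNReal.inv_ne_top.2 (omega_mul_ofReal_ne_zero n ht)))
    rw [← ENNReal.liminf_add_of_right_tendsto_zero herror]
    refine le_liminf_of_le (by isBoundedDefault) ?_
    filter_upwards [Ioo_mem_nhdsGT ht, hu] with ε hε huε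
    exact enorm_inner_mul_le_inv_mul_translationVariation_add hp huε z hε.1 hε.2.le htz
  have hfactor : Tendsto (fun t : ℝ => ENNReal.ofReal ((1 - 4 * t * ‖z‖) ^ n)) (𝓝[>] 0) (𝓝 1) := by
    have : Continuous fun t : ℝ => ENNReal.ofReal ((1 - 4 * t * ‖z‖) ^ n) :=
      ENNReal.continuous_ofReal.comp (by fun_prop)
    simpa using (this.tendsto 0).mono_left nhdsWithin_le_nhds
  have hsmall : ∀ᶠ t : ℝ in 𝓝[>] 0, 4 * t * ‖z‖ < 1 := by
    have : Continuous fun t : ℝ => 4 * t * ‖z‖ := by fun_prop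
    exact nhdsWithin_le_nhds (this.continuousAt.eventually_lt continuousAt_const (by simp))
  have hleft := ENNReal.Tendsto.const_mul (a := ‖(inner ℝ z p : ℝ)‖ₑ) hfactor
    (.inr enorm_ne_top)
  rw [mul_one] at hleft
  refine le_of_tendsto hleft ?_
  filter_upwards [hsmall, self_mem_nhdsWithin] with t htz ht using hbound t ht htz

end LowerBound

variable {n : ℕ} {K : Rd (n + 1) → ℝ≥0∞} {p : Rd (n + 1)}

theorem sigma_le_liminf_J1 (hK : AEMeasurable K) (hp : ‖p‖ = 1) {u : ℝ → Rd (n + 1) → ℝ}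
    (hu : ∀ᶠ ε in 𝓝[>] 0, AEStronglyMeasurable (u ε))
    (hlim : Tendsto (fun ε => eLpNorm (u ε - chi (halfspace p)) 1
      (volume.restrict (unitBall (n + 1)))) (𝓝[>] 0) (𝓝 0)) :
    sigma K p ≤ liminf (fun ε : ℝ => (omega n * ENNReal.ofReal ε)⁻¹ *
      J1 K ε (u ε) (unitBall (n + 1))) (𝓝[>] 0) := by
  set q : ℝ → Rd (n + 1) → ℝ≥0∞ := fun ε z => (omega n * ENNReal.ofReal ε)⁻¹ *
    translationVariation volume (unitBall (n + 1)) (u ε) (ε • z)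
  have hB : MeasurableSet (unitBall (n + 1)) := measurableSet_ball
  have hq : ∀ᶠ ε in 𝓝[>] 0, AEMeasurable fun z => K z * q ε z := hu.mono fun ε huε =>
    hK.mul ((aemeasurable_translationVariation_comp hB huε (measurable_const_smul ε)).const_mul _)
  calc sigma K p ≤ 2⁻¹ * ∫⁻ z, liminf (fun ε => K z * q ε z) (𝓝[>] 0) := by
        unfold sigma
        gcongr with z
        refine le_trans ?_ (const_mul_liminf_le _ _)
        gcongr
        exact enorm_inner_le_liminf_translationVariation hp hu hlim z
    _ ≤ 2⁻¹ * liminf (fun ε => ∫⁻ z, K z * q ε z) (𝓝[>] 0) := by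
        gcongr
        exact lintegral_liminf_le_of_eventually hq
    _ ≤ liminf (fun ε => 2⁻¹ * ∫⁻ z, K z * q ε z) (𝓝[>] 0) := const_mul_liminf_le _ _
    _ = liminf (fun ε : ℝ => (omega n * ENNReal.ofReal ε)⁻¹ *
          J1 K ε (u ε) (unitBall (n + 1))) (𝓝[>] 0) := by
        refine liminf_congr ?_
        filter_upwards [hu, self_mem_nhdsWithin] with ε huε hε
        exact (const_mul_J1_eq_lintegral hK hB huε hε
          (ENNReal.inv_ne_top.2 (omega_mul_ofReal_ne_zero n hε))).symm

theorem inv_mul_J1_halfspace_le_sigma (hK : AEMeasurable K) (hp : ‖p‖ = 1) {ε : ℝ}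
    (hε : 0 < ε) :
    (omega n * ENNReal.ofReal ε)⁻¹ * J1 K ε (chi (halfspace p)) (unitBall (n + 1)) ≤
      sigma K p := by
  rw [const_mul_J1_eq_lintegral hK (Ω := unitBall (n + 1)) measurableSet_ball
    (aestronglyMeasurable_chi (nullMeasurableSet_halfspace p)) hε
    (ENNReal.inv_ne_top.2 (omega_mul_ofReal_ne_zero n hε)), sigma]
  gcongr with z
  exact inv_mul_translationVariation_halfspace_le hp z hε

theorem liminf_J1_halfspace_eq_sigma (hK : AEMeasurable K) (hp : ‖p‖ = 1) :
    liminf (fun ε : ℝ => (omega n * ENNReal.ofReal ε)⁻¹ *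
      J1 K ε (chi (halfspace p)) (unitBall (n + 1))) (𝓝[>] 0) = sigma K p := by
  refine le_antisymm (liminf_le_of_frequently_le' (Eventually.frequently ?_))
    (sigma_le_liminf_J1 hK hp
      (.of_forall fun _ => aestronglyMeasurable_chi (nullMeasurableSet_halfspace p)) (by simp))
  filter_upwards [self_mem_nhdsWithin] with ε hε using inv_mul_J1_halfspace_le_sigma hK hp hε

end NonlocalPerimeter

open NonlocalPerimeter in
theorem lemma3p5_general {d : ℕ} {K : Rd d → ℝ≥0∞} (hK : AEMeasurable K) {p : Rd d}
    (hp : ‖p‖ = 1) :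
    IsLeast {l : ℝ≥0∞ | ∃ E ∈ admissible p,
      l = liminf (fun ε : ℝ => (omega (d - 1) * ENNReal.ofReal ε)⁻¹ *
        J1Set K ε (E ε) (unitBall d)) (𝓝[>] 0)} (sigma K p) := by
  obtain _ | n := d
  · exact absurd (hp.symm.trans (by rw [Subsingleton.elim p 0, norm_zero])) one_ne_zero
  refine ⟨⟨_, const_halfspace_mem_admissible p, (liminf_J1_halfspace_eq_sigma hK hp).symm⟩, ?_⟩
  rintro _ ⟨E, ⟨hE_meas, hE_lim⟩, rfl⟩
  refine sigma_le_liminf_J1 hK hp ?_ hE_lim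
  filter_upwards [self_mem_nhdsWithin] with ε hε using aestronglyMeasurable_chi (hE_meas ε hε)

theorem lemma3p5 {d : ℕ} (K : NonlocalPerimeter.Rd d → ℝ≥0∞)
    (hK_meas : AEMeasurable K volume)
    (hK_even : ∀ᵐ x ∂(volume : Measure (NonlocalPerimeter.Rd d)), K (-x) = K x)
    (hK_moment : ∫⁻ x, K x * ‖x‖ₑ < ∞)
    (p : NonlocalPerimeter.Rd d) (hp : ‖p‖ = 1) :
    NonlocalPerimeter.sigma K p =
      sInf {l : ℝ≥0∞ | ∃ E ∈ NonlocalPerimeter.admissible p,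
        l = liminf (fun ε : ℝ =>
          (NonlocalPerimeter.omega (d - 1) * ENNReal.ofReal ε)⁻¹ *
            NonlocalPerimeter.J1Set K ε (E ε) (NonlocalPerimeter.unitBall d)) (𝓝[>] 0)} :=
  (lemma3p5_general hK_meas hp).csInf_eq.symm
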